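/- **Conventions.** Let $q$ be a power of a prime $p$, let $\omega=e^{2\pi i/p}$, and for $(a|b)\in\mathbf F_q^{2n}$ let $\mathrm{swt}(a|b)=|\{i:(a_i,b_i)\neq(0,0)\}|$; for a set $X\subseteq\mathbf F_q^{2n}$ containing a nonzero vector let $\mathrm{swt}(X)=\min\{\mathrm{swt}(x): x\in X,\ x\ne 0\}$. For an additive code $C\subseteq \mathbf F_q^{2n}$ let $C^{\perp_s}$ be its dual with respect to the trace-symplectic form $\langle (a|b)\,|\,(a'|b')\rangle_s=\mathrm{tr}_{q/p}(a'\cdot b-a\cdot b')$, and put $D=C\cap C^{\perp_s}$. To $(a|b)$ belongs the error $X(a)Z(b)=\bigotimes_i X(a_i)Z(b_i)$ on $(\mathbf C^q)^{\otimes n}$, where $X(\alpha)|x\rangle=|x+\alpha\rangle$ and $Z(\beta)|x\rangle=\omega^{\mathrm{tr}(\beta x)}|x\rangle$. An additive code $C$ (possibly $C=\{0\}$) gives an $((n,K,R,d))_q$ (Clifford) subsystem code if $|C|=q^nR/K$, $|D|=q^n/(KR)$, there is a subspace $Q=A\otimes B$ of $(\mathbf C^q)^{\otimes n}$ with $\dim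 A=K$, $\dim B=R$ on which every error in $C$ acts as $1_A\otimes M$ for some operator $M$ on $B$, and such that every error $E$ of symplectic weight less than $d$ is detected by $A$ (that is, the compression of $E$ to $Q$ has the form $1_A\otimes M$), and $d=\mathrm{swt}(D^{\perp_s}\setminus C)$ if $D^{\perp_s}\ne C$, $d=\mathrm{swt}(D^{\perp_s})$ if $D^{\perp_s}=C$. It is pure if no nonzero element of $C$ has symplectic weight less than $d$, and $\mathbf F_q$-linear if $C$ is an $\mathbf F_q$-subspace. An $[[n,k,r,d]]_q$ code is an $((n,q^k,q^r,d))_q$ code; an $\mathbf F_q$-linear one is MDS if $k+r=n-2d+2$. **Corollary.** Let $q$ be a prime power. 1. A pure $\mathbf F_q$-linear $[[n,n-2d+2-r,r,d]]_q$ MDS subsystem code exists for all integers $n,d,r$ with $3\le n\le q$, $1\le d\le n/2+1$ and $0\le r\le n-2d+1$. 2. A pure $\mathbf F_q$-linear $[[(\nu+1)q,(\nu+1)q-2\nu-2-r,r,\nu+2]]_q$ MDS subsystem code exists for all integers $\nu,r$ with $0\le\nu\le q-2$ and $0\le r\le(\nu+1)q-2\nu-3$. 3. A pure $\mathbf F_q$-linear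 $[[q-1,q-1-2\delta-r,r,\delta+1]]_q$ MDS subsystem code exists for all integers $\delta,r$ with $0\le\delta<(q-1)/2$ and $0\le r\le q-2\delta-1$. 4. A pure $\mathbf F_q$-linear $[[q,q-2\delta-2-r,r,\delta+2]]_q$ MDS subsystem code exists for all integers $\delta,r$ with $0\le\delta<(q-1)/2$ and $0\le r<q-2\delta-2$. 5. A pure $\mathbf F_q$-linear $[[q^2-1,q^2-2\delta-1-r,r,\delta+1]]_q$ MDS subsystem code exists for all integers $\delta,r$ with $0\le\delta<q-1$ and $0\le r<q^2-2\delta-1$. 6. A pure $\mathbf F_q$-linear $[[q^2,q^2-2\delta-2-r,r,\delta+2]]_q$ MDS subsystem code exists for all integers $\delta,r$ with $0\le\delta<q-1$ and $0\le r<q^2-2\delta-2$. -/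

import Mathlib

open scoped Matrix Kronecker

namespace SubsystemCodes

noncomputable section Classical

variable (p : ℕ) [Fact p.Prime] (F : Type*) [Field F] [Fintype F] [DecidableEq F]
  [Algebra (ZMod p) F]

/-- The vectors `(a|b)` of `F_q^{2n}`, written as pairs of vectors of `F_q^n`. -/
abbrev Vec (n : ℕ) : Type _ := (Fin n → F) × (Fin n → F)

variable {F} {n : ℕ}

/-- Symplectic weight: the number of positions `i` with `(a_i, b_i) ≠ (0, 0)`. -/
def swt (v : Vec F n) : ℕ :=
  (Finset.univ.filter fun i : Fin n => (v.1 i, v.2 i) ≠ (0, 0)).card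

/-- `swt(X) = d`: the least symplectic weight of a nonzero element of `X` exists and is `d`. -/
def IsMinSwt (X : Set (Vec F n)) (d : ℕ) : Prop :=
  IsLeast (swt '' (X \ {0})) d

/-- Trace-symplectic product `⟨(a|b) | (a'|b')⟩ = tr_{q/p}(a' · b - a · b')`. -/
def traceSymp (u v : Vec F n) : ZMod p :=
  Algebra.trace (ZMod p) F (v.1 ⬝ᵥ u.2 - u.1 ⬝ᵥ v.2)

/-- Trace-symplectic dual of an additive code. -/
def traceSympDual (C : AddSubgroup (Vec F n)) : AddSubgroup (Vec F n) where
  carrier := {v | ∀ w ∈ C, traceSymp p v w = 0}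
  zero_mem' := by
    intro w _
    simp [traceSymp]
  add_mem' := by
    intro u v hu hv w hw
    have h : traceSymp p (u + v) w = traceSymp p u w + traceSymp p v w := by
      simp only [traceSymp, Prod.fst_add, Prod.snd_add, dotProduct_add, add_dotProduct]
      rw [← map_add]
      congr 1
      ring
    rw [h, hu w hw, hv w hw, add_zero]
  neg_mem' := by
    intro v hv w hw
    have h : traceSymp p (-v) w = -traceSymp p v w := by
      simp only [traceSymp, Prod.fst_neg, Prod.snd_neg, dotProduct_neg, neg_dotProduct]
      rw [← map_neg]
      congr 1
      ring
    rw [h, hv w hw, neg_zero]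

/-- The subcode `D = C ∩ C^⊥`. -/
def radical (C : AddSubgroup (Vec F n)) : AddSubgroup (Vec F n) :=
  C ⊓ traceSympDual p C

/-- The minimum distance of the Clifford subsystem code of `C`: `swt(D^⊥ - C)` if `D^⊥ ≠ C`,
and `swt(D^⊥)` if `D^⊥ = C`. -/
def IsMinDist (C : AddSubgroup (Vec F n)) (d : ℕ) : Prop :=
  (traceSympDual p (radical p C) ≠ C →
    IsMinSwt ((traceSympDual p (radical p C) : Set (Vec F n)) \ C) d) ∧
  (traceSympDual p (radical p C) = C →
    IsMinSwt (traceSympDual p (radical p C) : Set (Vec F n)) d)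

/-- `C` is pure to `d`: it has no nonzero element of symplectic weight less than `d`. -/
def IsPureTo (C : AddSubgroup (Vec F n)) (d : ℕ) : Prop :=
  ∀ v ∈ C, v ≠ 0 → d ≤ swt v

end Classical

noncomputable section Quantum

variable (p : ℕ) [Fact p.Prime] (F : Type*) [Field F] [Fintype F] [DecidableEq F]
  [Algebra (ZMod p) F]

variable {F} in
/-- `X(a)|x⟩ = |x + a⟩` on `ℂ^q`, in the computational basis indexed by `F_q`. -/
def shiftX (a : F) : Matrix F F ℂ :=
  Matrix.of fun y x => if y = x + a then 1 else 0

variable {F} in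
/-- `Z(b)|x⟩ = ω^{tr(bx)}|x⟩` with `ω = exp(2πi/p)`. -/
def phaseZ (b : F) : Matrix F F ℂ :=
  Matrix.diagonal fun x => ZMod.stdAddChar (Algebra.trace (ZMod p) F (b * x))

variable {F} in
/-- The error `X(a)Z(b) = X(a_1)Z(b_1) ⊗ ⋯ ⊗ X(a_n)Z(b_n)` on `(ℂ^q)^{⊗n}`, whose computational
basis is indexed by `F_q^n`. The error group consists of the multiples of these by powers of `ω`,
which make no difference for detection. -/
def errorOp {n : ℕ} (e : Vec F n) : Matrix (Fin n → F) (Fin n → F) ℂ :=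
  Matrix.of fun y x => ∏ i, (shiftX (e.1 i) * phaseZ p (e.2 i)) (y i) (x i)

/-- A subspace `Q = A ⊗ B` of `(ℂ^q)^{⊗n}` with `dim A = K`, `dim B = R`, given by the isometric
embedding of `ℂ^K ⊗ ℂ^R` whose image is `Q`. -/
structure Subsystem (n K R : ℕ) where
  emb : Matrix (Fin n → F) (Fin K × Fin R) ℂ
  isometry : embᴴ * emb = 1

variable {F} {n K R : ℕ}

/-- The operator `E` is detected by the subsystem `A`: compressed to `Q = A ⊗ B`,
it is of the form `1_A ⊗ M`. -/
def Subsystem.Detects (Q : Subsystem F n K R) (E : Matrix (Fin n → F) (Fin n → F) ℂ) : Prop :=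
  ∃ M : Matrix (Fin R) (Fin R) ℂ,
    Q.embᴴ * E * Q.emb = (1 : Matrix (Fin K) (Fin K) ℂ) ⊗ₖ M

/-- `Q = A ⊗ B` is the Clifford subsystem code derived from the additive code `C`: with
`D = C ∩ C^⊥`, one has `|C| = q^n R / K` and `|D| = q^n / (K R)`, and the errors in `C` map `Q`
to itself and act on it through the co-subsystem `B` only. (By the cardinalities, they then act
irreducibly on `B`, and `Q` is a full isotypic component of the group generated by them.) -/
structure Subsystem.DerivedFrom (Q : Subsystem F n K R) (C : AddSubgroup (Vec F n)) : Prop where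
  card_code : Nat.card C * K = Fintype.card F ^ n * R
  card_radical : Nat.card (radical p C) * (K * R) = Fintype.card F ^ n
  acts : ∀ e ∈ C, ∃ M : Matrix (Fin R) (Fin R) ℂ,
    errorOp p e * Q.emb = Q.emb * ((1 : Matrix (Fin K) (Fin K) ℂ) ⊗ₖ M)

variable (K R) in
/-- The additive code `C` gives rise to an `((n,K,R,d))_q` (Clifford) subsystem code. -/
def GivesCode (C : AddSubgroup (Vec F n)) (d : ℕ) : Prop :=
  (∃ Q : Subsystem F n K R, Q.DerivedFrom p C ∧
    ∀ e : Vec F n, swt e < d → Q.Detects (errorOp p e)) ∧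
  IsMinDist p C d

variable (F) in
/-- There is a pure `F_q`-linear `[[n,k,r,d]]_q` MDS subsystem code, where MDS means equality
in the Singleton bound `k + r ≤ n - 2d + 2`. -/
def ExistsPureLinearMDS (n k r d : ℕ) : Prop :=
  (∃ C : Submodule F (Vec F n),
    GivesCode p (Fintype.card F ^ k) (Fintype.card F ^ r) C.toAddSubgroup d ∧
    IsPureTo C.toAddSubgroup d) ∧
  k + r + 2 * d = n + 2

end Quantum

end SubsystemCodes

namespace SubsystemCodes

noncomputable section

/-! All six families follow from one criterion. Let `D` be an isotropic subspace of dimension `2m`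
whose symplectic dual `G = D^⊥` has no nonzero word of weight at most `m`. Then `G` has dimension
`2(n - m)` and meets the Singleton bound. The quotient `G / D` is symplectic of dimension `2(n -
2m)`, hence has a basis of hyperbolic pairs. Adjoining `r` of these pairs to `D` gives a code `C`
with radical `D`; the other `k` pairs act on the logical subsystem. Purity is inherited from `G`.
The distance is exactly `m + 1` because words of weight `m + 1` span `G`, so a proper subspace `C`
cannot contain them all (`exists_subsystem`, `le_of_forall_swt_le_mem`,
`existsPureLinearMDS_of_isotropic`).

Such `D` come from polynomials of degree less than `m` over the quadratic extension `E`, evaluated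
at `n` nodes and written in `F`-coordinates. Up to a nonzero constant the determinant form on `E =
F^2` is `x y^q - y x^q`, so isotropy reduces to the vanishing of the weighted power sums `∑ w_i
α_i^(a + q b)` for `a, b < m`; interpolation gives the bound on the dual weights
(`existsPureLinearMDS_of_evaluation`). What remains is to choose nodes and nonzero weights `w_i ∈
F`. Four choices suffice: points of `F` with Lagrange weights, unions of parallel lines in `E`, the
units of `E` weighted by norms, and all of `E`. -/

/-- The trace from a finite field to its prime field is a nondegenerate functional. -/
theorem eq_zero_of_trace_mul_eq_zero (p : ℕ) [Fact p.Prime] {F : Type*} [Field F] [Fintype F]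
    [Algebra (ZMod p) F] (a : F) (h : ∀ c : F, Algebra.trace (ZMod p) F (c * a) = 0) : a = 0 := by
  by_contra ha
  have hnd := traceForm_nondegenerate (ZMod p) F
  exact ha (hnd.2 a fun c => h c)

/-! ### The symplectic form and its relation to the trace form -/

section Symp
variable {F : Type*} [Field F] {n : ℕ}

/-- The `F`-bilinear symplectic form on `F^n × F^n`. -/
def sympForm (F : Type*) [Field F] (n : ℕ) : LinearMap.BilinForm F (Vec F n) :=
  LinearMap.mk₂ F (fun u v => v.1 ⬝ᵥ u.2 - u.1 ⬝ᵥ v.2)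
    (by intros; simp [dotProduct_add, add_dotProduct]; ring)
    (by intros; simp [mul_sub])
    (by intros; simp [dotProduct_add, add_dotProduct]; ring)
    (by intros; simp [mul_sub])

theorem sympForm_apply (u v : Vec F n) : sympForm F n u v = v.1 ⬝ᵥ u.2 - u.1 ⬝ᵥ v.2 := rfl

theorem sympForm_isAlt : (sympForm F n).IsAlt := by
  intro u
  rw [sympForm_apply]
  ring

theorem sympForm_neg (u v : Vec F n) : sympForm F n u v = -sympForm F n v u := by
  simp only [sympForm_apply]
  ring

theorem sympForm_nondegenerate : (sympForm F n).Nondegenerate := by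
  constructor <;> intro u hu <;> ext i
  · simpa [sympForm_apply] using hu (0, Pi.single i 1)
  · simpa [sympForm_apply] using hu (Pi.single i 1, 0)
  · simpa [sympForm_apply] using hu (0, Pi.single i 1)
  · simpa [sympForm_apply] using hu (Pi.single i 1, 0)

theorem finrank_vec : Module.finrank F (Vec F n) = n + n := by
  simp

theorem traceSymp_eq (p : ℕ) [Fact p.Prime] [Fintype F] [DecidableEq F] [Algebra (ZMod p) F]
    (u v : Vec F n) :
    traceSymp p u v = Algebra.trace (ZMod p) F (sympForm F n u v) := rfl

/-- For linear codes, the trace-symplectic dual is the orthogonal of the symplectic form. -/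
theorem traceSympDual_toAddSubgroup (p : ℕ) [Fact p.Prime] [Fintype F] [DecidableEq F]
    [Algebra (ZMod p) F] (C : Submodule F (Vec F n)) :
    traceSympDual p C.toAddSubgroup = ((sympForm F n).orthogonal C).toAddSubgroup := by
  ext v
  change (∀ w ∈ C, traceSymp p v w = 0) ↔ ∀ w ∈ C, sympForm F n w v = 0
  constructor
  · intro h w hw
    rw [sympForm_neg, neg_eq_zero]
    -- Linearity of `C` enters here: rescaling `w` by every `c` turns vanishing traces into a
    -- vanishing form.
    refine eq_zero_of_trace_mul_eq_zero p _ fun c => ?_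
    have := h (c • w) (C.smul_mem c hw)
    rwa [traceSymp_eq, map_smul, smul_eq_mul] at this
  · intro h w hw
    rw [traceSymp_eq, sympForm_neg, h w hw, neg_zero, map_zero]

end Symp

/-! ### Hyperbolic bases -/

section Hyperbolic
variable {F V : Type*} [Field F] [AddCommGroup V] [Module F V]

/-- A family of hyperbolic pairs `(x i, z i)`, mutually orthogonal. -/
structure IsHyperbolic (B : LinearMap.BilinForm F V) {ι : Type*} [DecidableEq ι]
    (x z : ι → V) : Prop where
  xz : ∀ i j, B (x i) (z j) = if i = j then 1 else 0
  xx : ∀ i j, B (x i) (x j) = 0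
  zz : ∀ i j, B (z i) (z j) = 0

/-- Modulo its radical `D`, the space `D^⊥` has a basis of hyperbolic pairs. -/
theorem exists_isHyperbolic [FiniteDimensional F V] (B : LinearMap.BilinForm F V)
    (hB : B.Nondegenerate) (hA : B.IsAlt) (n : ℕ) (hV : Module.finrank F V = n + n)
    (m : ℕ) : ∀ (D : Submodule F V), D ≤ B.orthogonal D → Module.finrank F D + m = n →
    ∃ x z : Fin m → V, (∀ i, x i ∈ B.orthogonal D) ∧ (∀ i, z i ∈ B.orthogonal D) ∧
      IsHyperbolic B x z := by
  have hneg : ∀ u v, B u v = -B v u := fun u v => (hA.neg_eq v u).symm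
  induction m with
  | zero =>
    intro D _ _
    exact ⟨fun i => i.elim0, fun i => i.elim0, fun i => i.elim0, fun i => i.elim0,
      ⟨fun i => i.elim0, fun i => i.elim0, fun i => i.elim0⟩⟩
  | succ m ih =>
    intro D hD hdim
    have hO := LinearMap.BilinForm.finrank_orthogonal hB D
    obtain ⟨z₀, hz₀, hz₀D⟩ : ∃ z₀ ∈ B.orthogonal D, z₀ ∉ D := by
      by_contra! hcon
      have := Submodule.finrank_mono (R := F) (s := B.orthogonal D) (t := D) hcon
      omega
    have hOO := LinearMap.BilinForm.orthogonal_orthogonal hB hA.isRefl D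
    obtain ⟨x₀, hx₀, hxz⟩ : ∃ x₀ ∈ B.orthogonal D, B x₀ z₀ = 1 := by
      rw [← hOO] at hz₀D
      have : ∃ y ∈ B.orthogonal D, B y z₀ ≠ 0 := by
        by_contra! hcon
        exact hz₀D (fun y hy => hcon y hy)
      obtain ⟨y, hy, hne⟩ := this
      refine ⟨(B y z₀)⁻¹ • y, Submodule.smul_mem _ _ hy, ?_⟩
      simp [hne]
    -- Adjoining `z₀` keeps the space isotropic and raises its dimension by one, so the induction
    -- hypothesis supplies the remaining `m` pairs.
    have hz₀s : D ⊔ F ∙ z₀ ≤ B.orthogonal (D ⊔ F ∙ z₀) := by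
      rw [sup_le_iff, Submodule.span_singleton_le_iff_mem]
      refine ⟨fun u hu => ?_, ?_⟩
      · rw [LinearMap.BilinForm.mem_orthogonal_iff]
        intro w hw
        obtain ⟨d, hd, e, he, rfl⟩ := Submodule.mem_sup.1 hw
        obtain ⟨c, rfl⟩ := Submodule.mem_span_singleton.1 he
        have h1 : B d u = 0 := hD hu d hd
        have h2 : B u z₀ = 0 := hz₀ u hu
        change B _ _ = 0
        simp [h1, hneg z₀ u, h2]
      · rw [LinearMap.BilinForm.mem_orthogonal_iff]
        intro w hw
        obtain ⟨d, hd, e, he, rfl⟩ := Submodule.mem_sup.1 hw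
        obtain ⟨c, rfl⟩ := Submodule.mem_span_singleton.1 he
        have h1 : B d z₀ = 0 := hz₀ d hd
        change B _ _ = 0
        simp [h1, hA z₀]
    have hdim' : Module.finrank F ↥(D ⊔ F ∙ z₀) + m = n := by
      have hlt : D < D ⊔ F ∙ z₀ := by
        refine lt_of_le_of_ne le_sup_left fun h => hz₀D ?_
        rw [h]
        exact Submodule.mem_sup_right (Submodule.mem_span_singleton_self z₀)
      have h1 := Submodule.finrank_lt_finrank_of_lt hlt
      have h2 := Submodule.finrank_add_le_finrank_add_finrank D (F ∙ z₀)
      have h3 := finrank_span_singleton (K := F) (v := z₀) (by rintro rfl; exact hz₀D D.zero_mem)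
      omega
    obtain ⟨x, z, hx, hz, H⟩ := ih _ hz₀s hdim'
    have hmono : B.orthogonal (D ⊔ F ∙ z₀) ≤ B.orthogonal D :=
      LinearMap.BilinForm.orthogonal_le le_sup_left
    have hmem : z₀ ∈ D ⊔ F ∙ z₀ :=
      Submodule.mem_sup_right (Submodule.mem_span_singleton_self z₀)
    have hz₀x : ∀ i, B z₀ (x i) = 0 := fun i => hx i z₀ hmem
    have hz₀z : ∀ i, B z₀ (z i) = 0 := fun i => hz i z₀ hmem
    have hxz₀ : ∀ i, B (x i) z₀ = 0 := fun i => by rw [hneg, hz₀x, neg_zero]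
    have hzz₀ : ∀ i, B (z i) z₀ = 0 := fun i => by rw [hneg, hz₀z, neg_zero]
    have hz₀x₀ : B z₀ x₀ = -1 := by rw [hneg, hxz]
    -- The inductive pairs are orthogonal to `z₀` but perhaps not to `x₀`. Since `B z₀ x₀ = -1`,
    -- these multiples of `z₀` cancel the pairing with `x₀`; all other pairings are unchanged
    -- because `z₀` is orthogonal to itself and to every old vector.
    refine ⟨Fin.cons x₀ fun i => x i + B (x i) x₀ • z₀,
      Fin.cons z₀ fun i => z i + B (z i) x₀ • z₀, ?_, ?_, ?_, ?_, ?_⟩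
    · refine Fin.cases hx₀ fun i => ?_
      exact Submodule.add_mem _ (hmono (hx i)) (Submodule.smul_mem _ _ hz₀)
    · refine Fin.cases hz₀ fun i => ?_
      exact Submodule.add_mem _ (hmono (hz i)) (Submodule.smul_mem _ _ hz₀)
    · refine Fin.cases (Fin.cases ?_ fun j => ?_) fun i => Fin.cases ?_ fun j => ?_
      · simp [hxz]
      · simp [hxz, hneg x₀ (z j)]
        intro h; exact absurd h.symm (Fin.succ_ne_zero j)
      · simp [hxz₀, hA z₀]
      · simp [hxz₀, hz₀z, hA z₀, H.xz]
    · refine Fin.cases (Fin.cases ?_ fun j => ?_) fun i => Fin.cases ?_ fun j => ?_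
      · simp [hA x₀]
      · simp [hxz, hneg x₀ (x j)]
      · simp [hz₀x₀]
      · simp [hxz₀, hz₀x, hA z₀, H.xx]
    · refine Fin.cases (Fin.cases ?_ fun j => ?_) fun i => Fin.cases ?_ fun j => ?_
      · simp [hA z₀]
      · simp [hz₀z, hA z₀]
      · simp [hzz₀, hA z₀]
      · simp [hzz₀, hz₀z, hA z₀, H.zz]

end Hyperbolic

/-! ### Error operators and their common eigenvectors -/

/-- A commuting family of endomorphisms of a nonzero complex vector space of finite dimension has
a common eigenvector. -/
theorem exists_common_eigenvector {V ι : Type*} [AddCommGroup V] [Module ℂ V]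
    [FiniteDimensional ℂ V] [Nontrivial V] (f : ι → Module.End ℂ V)
    (hf : ∀ i j, Commute (f i) (f j)) :
    ∃ v : V, v ≠ 0 ∧ ∀ i, ∃ c : ℂ, f i v = c • v := by
  let S : Set (Submodule ℂ V) := {W | W ≠ ⊥ ∧ ∀ i, ∀ v ∈ W, f i v ∈ W}
  have hS : S.Nonempty := ⟨⊤, top_ne_bot, fun _ _ _ => Submodule.mem_top⟩
  -- On a minimal nonzero invariant subspace `W` every `f i` is scalar: its eigenspace inside `W` is
  -- again invariant by commutation, hence all of `W`.
  obtain ⟨W, ⟨hW, hWf⟩, hmin⟩ := (wellFounded_lt (α := Submodule ℂ V)).has_min S hS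
  obtain ⟨v, hv, hv0⟩ := Submodule.exists_mem_ne_zero_of_ne_bot hW
  refine ⟨v, hv0, fun i => ?_⟩
  have : Nontrivial W := Submodule.nontrivial_iff_ne_bot.2 hW
  obtain ⟨c, hc⟩ := Module.End.exists_eigenvalue ((f i).restrict (hWf i))
  obtain ⟨u, hu, hu0⟩ := hc.exists_hasEigenvector
  have huc : f i u = c • (u : V) := by
    have := Module.End.mem_eigenspace_iff.1 hu
    simpa using congrArg Subtype.val this
  have hmem : W ⊓ (f i).eigenspace c ∈ S := by
    refine ⟨fun h => hu0 ?_, fun j w hw => ⟨hWf j w hw.1, ?_⟩⟩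
    · have : (u : V) ∈ W ⊓ (f i).eigenspace c := ⟨u.2, Module.End.mem_eigenspace_iff.2 huc⟩
      rw [h] at this
      exact Subtype.ext (by simpa using this)
    · have h1 := Module.End.mem_eigenspace_iff.1 hw.2
      have h2 : f i (f j w) = f j (f i w) := LinearMap.congr_fun (hf i j) w
      rw [SetLike.mem_coe, Module.End.mem_eigenspace_iff, h2, h1, map_smul]
  have hle : W ≤ W ⊓ (f i).eigenspace c := by
    by_contra h
    exact hmin _ hmem (lt_of_le_of_ne inf_le_left fun h' => h h'.ge)
  exact ⟨c, Module.End.mem_eigenspace_iff.1 (hle hv).2⟩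

section Errors
variable (p : ℕ) [Fact p.Prime] {F : Type*} [Field F] [Fintype F]
  [Algebra (ZMod p) F] {n : ℕ}

/-- The additive character `x ↦ ω^{tr x}`. -/
def traceChar (F : Type*) [Field F] [Fintype F] [Algebra (ZMod p) F] : AddChar F ℂ :=
  (ZMod.stdAddChar (N := p)).compAddMonoidHom (Algebra.trace (ZMod p) F).toAddMonoidHom

theorem traceChar_apply (x : F) :
    traceChar p F x = ZMod.stdAddChar (Algebra.trace (ZMod p) F x) := rfl

theorem star_traceChar_mul_self (x : F) : star (traceChar p F x) * traceChar p F x = 1 := by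
  rw [Complex.star_def, ← AddChar.map_neg_eq_conj, ← AddChar.map_add_eq_mul, neg_add_cancel,
    AddChar.map_zero_eq_one]

theorem traceChar_ne_zero (x : F) : traceChar p F x ≠ 0 := fun h => by
  simpa [h] using star_traceChar_mul_self p x

theorem traceChar_eq_one_iff (x : F) :
    traceChar p F x = 1 ↔ Algebra.trace (ZMod p) F x = 0 := by
  rw [traceChar_apply, ← AddChar.map_zero_eq_one (ZMod.stdAddChar (N := p)),
    ZMod.injective_stdAddChar.eq_iff]

theorem traceChar_sum {ι : Type*} (s : Finset ι) (f : ι → F) :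
    traceChar p F (∑ i ∈ s, f i) = ∏ i ∈ s, traceChar p F (f i) := by
  classical
  induction s using Finset.induction_on with
  | empty => simp
  | insert i s hi ih => rw [Finset.sum_insert hi, Finset.prod_insert hi, AddChar.map_add_eq_mul, ih]

variable [DecidableEq F]

theorem errorOp_apply (e : Vec F n) (y x : Fin n → F) :
    errorOp p e y x = if y = x + e.1 then traceChar p F (e.2 ⬝ᵥ x) else 0 := by
  have h1 : ∀ i, (shiftX (e.1 i) * phaseZ p (e.2 i)) (y i) (x i) =
      if y i = x i + e.1 i then traceChar p F (e.2 i * x i) else 0 := by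
    intro i
    simp [shiftX, phaseZ, Matrix.mul_diagonal, traceChar_apply]
  rw [errorOp, Matrix.of_apply, Finset.prod_congr rfl fun i _ => h1 i, Finset.prod_ite_zero]
  simp only [Finset.mem_univ, true_imp_iff, funext_iff, Pi.add_apply, dotProduct,
    traceChar_sum]

theorem errorOp_mul (u v : Vec F n) :
    errorOp p u * errorOp p v = traceChar p F (u.2 ⬝ᵥ v.1) • errorOp p (u + v) := by
  ext y x
  rw [Matrix.mul_apply, Finset.sum_eq_single (x + v.1)]
  · simp only [errorOp_apply, if_true, Matrix.smul_apply, smul_eq_mul, Prod.fst_add,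
      Prod.snd_add, ite_mul, mul_ite, zero_mul, mul_zero, ← AddChar.map_add_eq_mul,
      dotProduct_add, add_dotProduct]
    rw [add_right_comm x v.1 u.1, add_assoc x]
    congr 2
    ring
  · intro z _ hz
    rw [errorOp_apply p v, if_neg hz, mul_zero]
  · simp

theorem errorOp_zero : errorOp p (0 : Vec F n) = 1 := by
  ext y x
  simp [errorOp_apply, Matrix.one_apply]

theorem conjTranspose_errorOp_mul_self (u : Vec F n) : (errorOp p u)ᴴ * errorOp p u = 1 := by
  ext y x
  rw [Matrix.mul_apply, Finset.sum_eq_single (y + u.1)]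
  · simp only [Matrix.conjTranspose_apply, errorOp_apply, if_true, add_left_inj, mul_ite,
      mul_zero, Matrix.one_apply]
    split_ifs with h
    · rw [h, star_traceChar_mul_self]
    · rfl
  · intro z _ hz
    rw [Matrix.conjTranspose_apply, errorOp_apply, if_neg hz, star_zero, zero_mul]
  · simp

theorem errorOp_add (u v : Vec F n) : errorOp p (u + v) =
    (traceChar p F (u.2 ⬝ᵥ v.1))⁻¹ • (errorOp p u * errorOp p v) := by
  rw [errorOp_mul, inv_smul_smul₀ (traceChar_ne_zero p _)]

/-- Only the phases of the two products differ. Thus isotropic subspaces give commuting operators,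
and an error outside `D^⊥` picks up a nontrivial phase against some element of `D`. -/
theorem errorOp_mul_comm (u v : Vec F n) : errorOp p u * errorOp p v =
    traceChar p F (sympForm F n u v) • (errorOp p v * errorOp p u) := by
  rw [errorOp_mul, errorOp_mul, smul_smul, ← AddChar.map_add_eq_mul, add_comm v u, sympForm_apply]
  congr 2
  rw [dotProduct_comm v.2, dotProduct_comm u.2]
  ring

theorem errorOp_mulVec_comm (u v : Vec F n) (φ : (Fin n → F) → ℂ) :
    errorOp p u *ᵥ errorOp p v *ᵥ φ =
      traceChar p F (sympForm F n u v) • errorOp p v *ᵥ errorOp p u *ᵥ φ := by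
  rw [Matrix.mulVec_mulVec, errorOp_mul_comm, Matrix.smul_mulVec, Matrix.mulVec_mulVec]

theorem star_errorOp_mulVec_dotProduct (u : Vec F n) (φ ψ : (Fin n → F) → ℂ) :
    star (errorOp p u *ᵥ φ) ⬝ᵥ (errorOp p u *ᵥ ψ) = star φ ⬝ᵥ ψ := by
  rw [Matrix.star_mulVec, Matrix.dotProduct_mulVec, Matrix.vecMul_vecMul,
    conjTranspose_errorOp_mul_self, Matrix.vecMul_one]

/-- The errors of an isotropic subspace have a common normalized eigenvector. -/
theorem exists_stabilized (M : Submodule F (Vec F n)) (hM : M ≤ (sympForm F n).orthogonal M) :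
    ∃ (φ : (Fin n → F) → ℂ) (c : Vec F n → ℂ), star φ ⬝ᵥ φ = 1 ∧
      ∀ m ∈ M, errorOp p m *ᵥ φ = c m • φ ∧ star (c m) * c m = 1 := by
  obtain ⟨v, hv, h⟩ := exists_common_eigenvector
    (fun m : M => Matrix.mulVecLin (errorOp p (m : Vec F n))) (by
      intro u v
      have h0 : sympForm F n u v = 0 := hM v.2 u u.2
      change _ * _ = _ * _
      simp only [Module.End.mul_eq_comp, ← Matrix.mulVecLin_mul]
      rw [errorOp_mul_comm, h0, AddChar.map_zero_eq_one, one_smul])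
  choose c hc using h
  set t : ℝ := ∑ i, Complex.normSq (v i) with ht_def
  have hre : (t : ℂ) = star v ⬝ᵥ v := by
    simp [ht_def, dotProduct, Complex.normSq_eq_conj_mul_self]
  have ht : 0 < t := by
    obtain ⟨i, hi⟩ := Function.ne_iff.1 hv
    exact Finset.sum_pos' (fun i _ => Complex.normSq_nonneg _)
      ⟨i, Finset.mem_univ i, Complex.normSq_pos.2 hi⟩
  have hsq : ((√t : ℝ) : ℂ) * (√t : ℝ) = t := by rw [← Complex.ofReal_mul, Real.mul_self_sqrt ht.le]
  have hne : ((√t : ℝ) : ℂ) ≠ 0 := by simpa using (Real.sqrt_pos.2 ht).ne'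
  have hφ : star (((√t : ℝ) : ℂ)⁻¹ • v) ⬝ᵥ (((√t : ℝ) : ℂ)⁻¹ • v) = 1 := by
    rw [star_smul, smul_dotProduct, dotProduct_smul, ← hre, ← hsq]
    simp
    field_simp
  have hcφ : ∀ m (hm : m ∈ M), errorOp p m *ᵥ (((√t : ℝ) : ℂ)⁻¹ • v) =
      c ⟨m, hm⟩ • (((√t : ℝ) : ℂ)⁻¹ • v) := by
    intro m hm
    have := hc ⟨m, hm⟩
    rw [Matrix.mulVecLin_apply] at this
    rw [Matrix.mulVec_smul, this, smul_comm]
  classical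
  refine ⟨_, fun m => if hm : m ∈ M then c ⟨m, hm⟩ else 0, hφ, fun m hm => ?_⟩
  simp only [dif_pos hm]
  refine ⟨hcφ m hm, ?_⟩
  -- Errors are unitary, so their eigenvalues have modulus one.
  have := star_errorOp_mulVec_dotProduct p m (((√t : ℝ) : ℂ)⁻¹ • v) (((√t : ℝ) : ℂ)⁻¹ • v)
  rw [hcφ m hm, star_smul, smul_dotProduct, dotProduct_smul, hφ] at this
  simpa using this

end Errors

/-! ### The gauge code spanned by `D` and `r` hyperbolic pairs -/

section Extension
variable {F V : Type*} [Field F] [AddCommGroup V] [Module F V] {B : LinearMap.BilinForm F V}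
  {ι : Type*} [Fintype ι] {x z : ι → V}

theorem linearCombination_mem {W : Submodule F V} (hx : ∀ i, x i ∈ W) (g : ι → F) :
    Fintype.linearCombination F x g ∈ W := by
  rw [Fintype.linearCombination_apply]
  exact W.sum_mem fun i _ => W.smul_mem _ (hx i)

variable [DecidableEq ι]

theorem IsHyperbolic.apply_xz (H : IsHyperbolic B x z) (g h : ι → F) :
    B (Fintype.linearCombination F x g) (Fintype.linearCombination F z h) = g ⬝ᵥ h := by
  simp [Fintype.linearCombination_apply, H.xz, dotProduct, mul_comm]

theorem IsHyperbolic.apply_xx (H : IsHyperbolic B x z) (g h : ι → F) :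
    B (Fintype.linearCombination F x g) (Fintype.linearCombination F x h) = 0 := by
  simp [Fintype.linearCombination_apply, H.xx]

theorem IsHyperbolic.apply_zz (H : IsHyperbolic B x z) (g h : ι → F) :
    B (Fintype.linearCombination F z g) (Fintype.linearCombination F z h) = 0 := by
  simp [Fintype.linearCombination_apply, H.zz]

/-- Extension of coordinate vectors by zero along the left summand. -/
def padRight (F : Type*) [Field F] (r k : ℕ) : (Fin r → F) →ₗ[F] (Fin r ⊕ Fin k → F) where
  toFun b := Sum.elim b 0
  map_add' b c := by ext (i | i) <;> simp
  map_smul' c b := by ext (i | i) <;> simp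

/-- Extension of coordinate vectors by zero along the right summand. -/
def padLeft (F : Type*) [Field F] (r k : ℕ) : (Fin k → F) →ₗ[F] (Fin r ⊕ Fin k → F) where
  toFun a := Sum.elim 0 a
  map_add' b c := by ext (i | i) <;> simp
  map_smul' c b := by ext (i | i) <;> simp

theorem padRight_dotProduct_padLeft {r k : ℕ} (b : Fin r → F) (a : Fin k → F) :
    padRight F r k b ⬝ᵥ padLeft F r k a = 0 := by
  simp [padRight, padLeft, dotProduct]

theorem padRight_dotProduct_padRight {r k : ℕ} (b c : Fin r → F) :
    padRight F r k b ⬝ᵥ padRight F r k c = b ⬝ᵥ c := by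
  simp [padRight, dotProduct]

/-- The parametrization of the code spanned by `D` and the first `r` hyperbolic pairs. -/
def gaugeMap (D : Submodule F V) {r k : ℕ} (x z : Fin r ⊕ Fin k → V) :
    (D × (Fin r → F) × (Fin r → F)) →ₗ[F] V :=
  D.subtype.coprod
    ((Fintype.linearCombination F x ∘ₗ padRight F r k).coprod
      (Fintype.linearCombination F z ∘ₗ padRight F r k))

theorem gaugeMap_apply (D : Submodule F V) {r k : ℕ} (x z : Fin r ⊕ Fin k → V)
    (d : D) (b c : Fin r → F) : gaugeMap D x z (d, b, c) = d +
      (Fintype.linearCombination F x (padRight F r k b) +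
        Fintype.linearCombination F z (padRight F r k c)) := rfl

/-- Pairing with the gauge vectors `x i` and `z i` reads off the hyperbolic coordinates up to sign.
This identifies the radical of the gauge code with `D`, and also gives injectivity, since a kernel
element is orthogonal to everything. -/
theorem gaugeMap_eq_of_orthogonal {D : Submodule F V} {r k : ℕ} {x z : Fin r ⊕ Fin k → V}
    (hA : B.IsAlt) (H : IsHyperbolic B x z) (hx : ∀ i, x i ∈ B.orthogonal D)
    (hz : ∀ i, z i ∈ B.orthogonal D) (w : D × (Fin r → F) × (Fin r → F))
    (hw : ∀ u, B (gaugeMap D x z u) (gaugeMap D x z w) = 0) : w.2 = 0 := by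
  obtain ⟨d, b, c⟩ := w
  have hdx : ∀ g, B (Fintype.linearCombination F x g) d = 0 := fun g => by
    rw [← hA.neg_eq, show B d _ = 0 from linearCombination_mem hx g d d.2, neg_zero]
  have hdz : ∀ g, B (Fintype.linearCombination F z g) d = 0 := fun g => by
    rw [← hA.neg_eq, show B d _ = 0 from linearCombination_mem hz g d d.2, neg_zero]
  have hzx : ∀ g h, B (Fintype.linearCombination F z g) (Fintype.linearCombination F x h) =
      -(h ⬝ᵥ g) := fun g h => by rw [← hA.neg_eq, H.apply_xz]
  refine Prod.ext (funext fun i => ?_) (funext fun i => ?_)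
  · have := hw (0, 0, Pi.single i 1)
    simpa [gaugeMap_apply, hdz, hzx, H.apply_zz, padRight_dotProduct_padRight] using this
  · have := hw (0, Pi.single i 1, 0)
    simpa [gaugeMap_apply, hdx, H.apply_xz, H.apply_xx, padRight_dotProduct_padRight] using this

theorem gaugeMap_injective {D : Submodule F V} {r k : ℕ} {x z : Fin r ⊕ Fin k → V}
    (hA : B.IsAlt) (H : IsHyperbolic B x z) (hx : ∀ i, x i ∈ B.orthogonal D)
    (hz : ∀ i, z i ∈ B.orthogonal D) : Function.Injective (gaugeMap D x z) := by
  rw [← LinearMap.ker_eq_bot, LinearMap.ker_eq_bot']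
  intro w hw
  have h2 := gaugeMap_eq_of_orthogonal hA H hx hz w fun u => by rw [hw, map_zero]
  obtain ⟨d, bc⟩ := w
  obtain rfl : bc = 0 := h2
  have : (d : V) = 0 := by simpa [gaugeMap] using hw
  ext1
  · exact Subtype.ext this
  · rfl

end Extension

/-! ### The subsystem code of an isotropic space -/

section Quantum
variable (p : ℕ) [Fact p.Prime] {F : Type*} [Field F] [Fintype F] [DecidableEq F]
  [Algebra (ZMod p) F] {n : ℕ}

/-- The subsystem code obtained from an isotropic space `D` by declaring `r` of the hyperbolic
pairs in `D^⊥` to be gauge degrees of freedom. -/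
theorem exists_subsystem (D : Submodule F (Vec F n)) (hD : D ≤ (sympForm F n).orthogonal D)
    (k r : ℕ) (hdim : Module.finrank F D + (r + k) = n) :
    ∃ C : Submodule F (Vec F n), D ≤ C ∧ C ≤ (sympForm F n).orthogonal D ∧
      radical p C.toAddSubgroup = D.toAddSubgroup ∧
      ∃ Q : Subsystem F n (Fintype.card F ^ k) (Fintype.card F ^ r),
        Q.DerivedFrom p C.toAddSubgroup ∧
        ∀ e, e ∉ (sympForm F n).orthogonal D → Q.Detects (errorOp p e) := by
  obtain ⟨x', z', hx', hz', H'⟩ := exists_isHyperbolic (sympForm F n) sympForm_nondegenerate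
    sympForm_isAlt n finrank_vec (r + k) D hD hdim
  obtain ⟨x, z, hx, hz, H⟩ : ∃ x z : Fin r ⊕ Fin k → Vec F n,
      (∀ i, x i ∈ (sympForm F n).orthogonal D) ∧ (∀ i, z i ∈ (sympForm F n).orthogonal D) ∧
      IsHyperbolic (sympForm F n) x z :=
    ⟨x' ∘ finSumFinEquiv, z' ∘ finSumFinEquiv, fun i => hx' _, fun i => hz' _,
      fun i j => by simp [H'.xz], fun i j => H'.xx _ _, fun i j => H'.zz _ _⟩
  set S := Fintype.linearCombination F x
  set T := Fintype.linearCombination F z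
  have hDS : ∀ d ∈ D, ∀ g, sympForm F n d (S g) = 0 := fun d hd g => linearCombination_mem hx g d hd
  have hDT : ∀ d ∈ D, ∀ g, sympForm F n d (T g) = 0 := fun d hd g => linearCombination_mem hz g d hd
  have hTS : ∀ g h, sympForm F n (T g) (S h) = -(h ⬝ᵥ g) := fun g h => by
    rw [sympForm_neg, H.apply_xz]
  -- a common eigenvector of the Lagrangian subspace spanned by `D` and all `z i`
  let M : Submodule F (Vec F n) := D ⊔ LinearMap.range T
  have hDM : D ≤ M := le_sup_left
  have hTM : ∀ g, T g ∈ M := fun g => Submodule.mem_sup_right ⟨g, rfl⟩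
  have hM : M ≤ (sympForm F n).orthogonal M := by
    intro u hu w hw
    obtain ⟨d, hd, _, ⟨g, rfl⟩, rfl⟩ := Submodule.mem_sup.1 hu
    obtain ⟨d', hd', _, ⟨g', rfl⟩, rfl⟩ := Submodule.mem_sup.1 hw
    change sympForm F n (d' + T g') (d + T g) = 0
    rw [map_add, map_add, LinearMap.add_apply, LinearMap.add_apply, hDT d' hd',
      H.apply_zz, show sympForm F n d' d = 0 from hD hd d' hd', sympForm_neg, hDT d hd]
    simp
  obtain ⟨φ, c, hφ, hc⟩ := exists_stabilized p M hM
  -- Translates of the stabilized state by combinations of the `x i`: `a` labels the logical basis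
  -- states and `b` the gauge basis states.
  let ψ : (Fin k → F) → (Fin r → F) → (Fin n → F) → ℂ := fun a b =>
    errorOp p (S (padLeft F r k a)) *ᵥ errorOp p (S (padRight F r k b)) *ᵥ φ
  have hψM : ∀ m ∈ M, ∀ a b, errorOp p m *ᵥ ψ a b =
      (traceChar p F (sympForm F n m (S (padLeft F r k a + padRight F r k b))) * c m) • ψ a b := by
    intro m hm a b
    simp only [ψ]
    rw [errorOp_mulVec_comm, errorOp_mulVec_comm p m, (hc m hm).1, Matrix.mulVec_smul,
      Matrix.mulVec_smul, Matrix.mulVec_smul, smul_smul, smul_smul, map_add, map_add,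
      AddChar.map_add_eq_mul]
  have hψ1 : ∀ a b, star (ψ a b) ⬝ᵥ ψ a b = 1 := fun a b => by
    simp only [ψ]
    rw [star_errorOp_mulVec_dotProduct, star_errorOp_mulVec_dotProduct, hφ]
  have hψ0 : ∀ a b a' b', (a, b) ≠ (a', b') → star (ψ a b) ⬝ᵥ ψ a' b' = 0 := by
    intro a b a' b' hne
    set g := padLeft F r k a + padRight F r k b with hg
    set g' := padLeft F r k a' + padRight F r k b' with hg'
    obtain ⟨i, hi⟩ : ∃ i, g i - g' i ≠ 0 := by
      by_contra! hcon
      refine hne (Prod.ext (funext fun i => ?_) (funext fun i => ?_))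
      · simpa [hg, hg', padLeft, padRight, sub_eq_zero] using hcon (Sum.inr i)
      · simpa [hg, hg', padLeft, padRight, sub_eq_zero] using hcon (Sum.inl i)
    -- Different labels are separated by a multiple of some `z i`: for suitable `t` it acts on the
    -- two states with different eigenvalues, and unitarity makes them orthogonal.
    obtain ⟨t, ht⟩ : ∃ t : F, Algebra.trace (ZMod p) F (t * (g i - g' i)) ≠ 0 := by
      by_contra! hcon
      exact hi (eq_zero_of_trace_mul_eq_zero p _ hcon)
    have h1 := hψM _ (hTM (Pi.single i t)) a b
    have h2 := hψM _ (hTM (Pi.single i t)) a' b'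
    rw [hTS, ← hg] at h1
    rw [hTS, ← hg'] at h2
    have h3 := star_errorOp_mulVec_dotProduct p (T (Pi.single i t)) (ψ a b) (ψ a' b')
    rw [h1, h2, star_smul, smul_dotProduct, dotProduct_smul, smul_smul, smul_eq_mul, star_mul,
      Complex.star_def, ← AddChar.map_neg_eq_conj] at h3
    have h4 := (hc _ (hTM (Pi.single i t))).2
    rw [Complex.star_def] at h4
    have h5 : traceChar p F (t * (g i - g' i)) * (star (ψ a b) ⬝ᵥ ψ a' b') =
        star (ψ a b) ⬝ᵥ ψ a' b' := by
      have : t * (g i - g' i) = -(-(g ⬝ᵥ Pi.single i t)) + -(g' ⬝ᵥ Pi.single i t) := by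
        rw [dotProduct_single, dotProduct_single]
        ring
      rw [this, AddChar.map_add_eq_mul]
      linear_combination h3 - (traceChar p F (-(-(g ⬝ᵥ Pi.single i t))) *
        traceChar p F (-(g' ⬝ᵥ Pi.single i t)) * (star (ψ a b) ⬝ᵥ ψ a' b')) * h4
    by_contra hX
    exact ht ((traceChar_eq_one_iff p _).1 (mul_right_cancel₀ hX (by rw [h5, one_mul])))
  let ea : Fin (Fintype.card F ^ k) ≃ (Fin k → F) :=
    (Fintype.equivFinOfCardEq (by simp)).symm
  let eb : Fin (Fintype.card F ^ r) ≃ (Fin r → F) :=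
    (Fintype.equivFinOfCardEq (by simp)).symm
  let P : Matrix (Fin n → F) (Fin (Fintype.card F ^ k) × Fin (Fintype.card F ^ r)) ℂ :=
    Matrix.of fun y ij => ψ (ea ij.1) (eb ij.2) y
  have hPiso : Pᴴ * P = 1 := by
    ext ⟨i, j⟩ ⟨i', j'⟩
    change star (ψ (ea i) (eb j)) ⬝ᵥ ψ (ea i') (eb j') = _
    rw [Matrix.one_apply]
    split_ifs with h
    · cases h
      exact hψ1 _ _
    · refine hψ0 _ _ _ _ fun h' => h ?_
      rw [Prod.mk.injEq] at h' ⊢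
      exact ⟨ea.injective h'.1, eb.injective h'.2⟩
  have hPD : ∀ w ∈ D, errorOp p w * P = c w • P := by
    intro w hw
    ext y ⟨i, j⟩
    have := congrFun (hψM w (hDM hw) (ea i) (eb j)) y
    rw [hDS w hw, AddChar.map_zero_eq_one, one_mul] at this
    exact this
  let C := LinearMap.range (gaugeMap D x z)
  -- An error of `C` commutes with the logical translations. On the gauge label it shifts by `β`,
  -- while its part in `M` acts on `φ` by a scalar; hence `κ` depends on `b` but not on `a`.
  have hact : ∀ e ∈ C, ∃ (β : Fin r → F) (κ : (Fin r → F) → ℂ), ∀ a b,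
      errorOp p e *ᵥ ψ a b = κ b • ψ a (b + β) := by
    rintro _ ⟨⟨d, β, γ⟩, rfl⟩
    rw [gaugeMap_apply]
    set e := (d : Vec F n) + (S (padRight F r k β) + T (padRight F r k γ)) with he
    set m := (d : Vec F n) + T (padRight F r k γ) with hm
    have hmM : m ∈ M := M.add_mem (hDM d.2) (hTM _)
    refine ⟨β, fun b => traceChar p F (e.2 ⬝ᵥ (S (padRight F r k b)).1) *
      ((traceChar p F ((S (padRight F r k (b + β))).2 ⬝ᵥ m.1))⁻¹ * c m), fun a b => ?_⟩
    have h0 : sympForm F n e (S (padLeft F r k a)) = 0 := by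
      rw [he, map_add, map_add, LinearMap.add_apply, LinearMap.add_apply, hDS d d.2, H.apply_xx,
        hTS, dotProduct_comm, padRight_dotProduct_padLeft]
      simp
    have h1 : e + S (padRight F r k b) = S (padRight F r k (b + β)) + m := by
      rw [he, hm, map_add, map_add]
      abel
    simp only [ψ]
    rw [errorOp_mulVec_comm, h0, AddChar.map_zero_eq_one, one_smul, Matrix.mulVec_mulVec φ,
      errorOp_mul, h1, errorOp_add, smul_smul, Matrix.smul_mulVec, ← Matrix.mulVec_mulVec φ,
      (hc m hmM).1, Matrix.mulVec_smul, Matrix.mulVec_smul, Matrix.mulVec_smul, smul_smul, mul_assoc]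
  have hCD : ∀ u ∈ C, ∀ d ∈ D, sympForm F n d u = 0 := by
    rintro _ ⟨⟨d, β, γ⟩, rfl⟩ d' hd'
    rw [gaugeMap_apply, map_add, map_add, hDS d' hd', hDT d' hd',
      show sympForm F n d' d = 0 from hD d.2 d' hd']
    simp
  have hDC : D ≤ C := fun d hd => ⟨(⟨d, hd⟩, 0, 0), by simp [gaugeMap_apply]⟩
  have hrad : radical p C.toAddSubgroup = D.toAddSubgroup := by
    rw [radical, traceSympDual_toAddSubgroup]
    ext v
    constructor
    · rintro ⟨⟨w, rfl⟩, hv⟩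
      have := gaugeMap_eq_of_orthogonal sympForm_isAlt H hx hz w fun u => hv _ ⟨u, rfl⟩
      obtain ⟨d, bc⟩ := w
      obtain rfl : bc = 0 := this
      change gaugeMap D x z (d, 0, 0) ∈ D
      simp [gaugeMap_apply]
    · intro hv
      refine ⟨hDC hv, fun u hu => ?_⟩
      change sympForm F n u v = 0
      rw [sympForm_neg, hCD u hu v hv, neg_zero]
  have hcardC : Nat.card C = Fintype.card F ^ (Module.finrank F D + (r + r)) := by
    rw [Module.natCard_eq_pow_finrank (K := F),
      LinearMap.finrank_range_of_inj (gaugeMap_injective sympForm_isAlt H hx hz)]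
    simp
  have hcardD : Nat.card D = Fintype.card F ^ Module.finrank F D := by
    rw [Module.natCard_eq_pow_finrank (K := F), Nat.card_eq_fintype_card]
  refine ⟨C, hDC, fun u hu d hd => hCD u hu d hd, hrad, ⟨P, hPiso⟩, ⟨?_, ?_, ?_⟩, ?_⟩
  · change Nat.card C * _ = _
    rw [hcardC, ← pow_add, ← pow_add]
    congr 1
    omega
  · rw [hrad]
    change Nat.card D * _ = _
    rw [hcardD, ← pow_add, ← pow_add]
    congr 1
    omega
  · intro e he
    obtain ⟨β, κ, h⟩ := hact e he
    refine ⟨Matrix.of fun j' j => if eb j' = eb j + β then κ (eb j) else 0, ?_⟩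
    ext y ⟨i, j⟩
    have hl : (errorOp p e * P) y (i, j) = κ (eb j) * ψ (ea i) (eb j + β) y :=
      congrFun (h (ea i) (eb j)) y
    rw [hl, Matrix.mul_apply, Finset.sum_eq_single (i, eb.symm (eb j + β))]
    · simp [P, mul_comm]
    · rintro ⟨i', j'⟩ _ hne
      rw [Matrix.kroneckerMap_apply, Matrix.one_apply, Matrix.of_apply]
      split_ifs with h1 h2
      · refine absurd (Prod.ext (show i' = i from h1) ?_) hne
        change j' = eb.symm (eb j + β)
        change eb j' = eb j + β at h2
        rw [← h2, Equiv.symm_apply_apply]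
      all_goals simp
    · simp
  · intro e he
    -- `w` acts on the code space as a scalar of modulus one but commutes with `e` only up to a
    -- phase different from one. So the compression of `e` equals a nontrivial multiple of itself
    -- and vanishes.
    obtain ⟨w, hw, hew⟩ : ∃ w ∈ D, Algebra.trace (ZMod p) F (sympForm F n e w) ≠ 0 := by
      by_contra! hcon
      have : e ∈ traceSympDual p D.toAddSubgroup := fun w hw => hcon w hw
      rw [traceSympDual_toAddSubgroup] at this
      exact he this
    refine ⟨0, ?_⟩
    rw [Matrix.kronecker_zero]
    change Pᴴ * errorOp p e * P = 0
    have h1 : star (c w) • (Pᴴ * errorOp p w) = Pᴴ := by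
      have : Pᴴ * (errorOp p w)ᴴ = star (c w) • Pᴴ := by
        rw [← Matrix.conjTranspose_mul, hPD w hw, Matrix.conjTranspose_smul]
      rw [← Matrix.smul_mul, ← this, Matrix.mul_assoc, conjTranspose_errorOp_mul_self,
        Matrix.mul_one]
    have h2 : Pᴴ * errorOp p e * P =
        traceChar p F (sympForm F n w e) • (Pᴴ * errorOp p e * P) := by
      conv_lhs => rw [← h1]
      rw [Matrix.smul_mul, Matrix.smul_mul, Matrix.mul_assoc Pᴴ, errorOp_mul_comm p w e,
        Matrix.mul_smul, Matrix.smul_mul, ← Matrix.mul_assoc, Matrix.mul_assoc _ _ P, hPD w hw,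
        Matrix.mul_smul, smul_smul, smul_smul, mul_right_comm, (hc w (hDM hw)).2, one_mul]
    have h3 : traceChar p F (sympForm F n w e) ≠ 1 := by
      rw [Ne, traceChar_eq_one_iff, sympForm_neg, map_neg, neg_eq_zero]
      exact hew
    have h4 : (traceChar p F (sympForm F n w e) - 1) • (Pᴴ * errorOp p e * P) = 0 := by
      rw [sub_smul, one_smul, ← h2, sub_self]
    exact (smul_eq_zero.1 h4).resolve_left (sub_ne_zero.2 h3)

end Quantum

/-! ### Symplectic weight and the Singleton bound -/

section Weight
variable {F : Type*} [Field F] [DecidableEq F] {n : ℕ}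

theorem swt_le_card (v : Vec F n) (s : Finset (Fin n))
    (h : ∀ i, i ∉ s → (v.1 i, v.2 i) = (0, 0)) : swt v ≤ s.card := by
  refine Finset.card_le_card fun i hi => ?_
  by_contra hs
  exact (Finset.mem_filter.1 hi).2 (h i hs)

/-- The restriction of a vector to the first `N` positions. -/
def firstPositions (F : Type*) [Field F] {n N : ℕ} (h : N ≤ n) :
    Vec F n →ₗ[F] (Fin N → F × F) where
  toFun v j := (v.1 (Fin.castLE h j), v.2 (Fin.castLE h j))
  map_add' _ _ := rfl
  map_smul' _ _ := rfl

theorem card_filter_le_val {N : ℕ} (h : N ≤ n) :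
    (Finset.univ.filter fun i : Fin n => N ≤ i).card + N = n := by
  have h1 := Finset.card_filter_add_card_filter_not (s := (Finset.univ : Finset (Fin n)))
    (fun i => N ≤ (i : ℕ))
  have h2 : (Finset.univ.filter fun i : Fin n => ¬ N ≤ i).card = N := by
    simp only [not_le, Fin.card_filter_val_lt, min_eq_right h]
  rw [h2] at h1
  simpa using h1

/-- A code meeting the Singleton bound is generated by its words of minimum weight. -/
theorem le_of_forall_swt_le_mem (G C : Submodule F (Vec F n)) (m : ℕ) (hmn : m ≤ n)
    (hG : Module.finrank F G + 2 * m = 2 * n) (hwt : ∀ v ∈ G, v ≠ 0 → m < swt v)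
    (hC : ∀ v ∈ G, swt v ≤ m + 1 → v ∈ C) : G ≤ C := by
  -- A word of `G` vanishing on the first `N` positions has weight at most `m`, so it is zero.
  -- Equality of dimensions makes this projection an isomorphism from `G` onto `(F × F)^N`.
  let N := n - m
  have hN : N ≤ n := Nat.sub_le _ _
  let π := firstPositions F hN
  let T : Finset (Fin n) := Finset.univ.filter fun i : Fin n => N ≤ i
  have hT : T.card = m := by
    have := card_filter_le_val hN
    change T.card + N = n at this
    omega
  have hval : ∀ i : Fin n, i ∉ T → ∃ j : Fin N, Fin.castLE hN j = i := fun i hi => by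
    have : (i : ℕ) < N := by simpa [T] using hi
    exact ⟨⟨i, this⟩, rfl⟩
  have hinj : ∀ v ∈ G, π v = 0 → v = 0 := by
    intro v hv h0
    by_contra hne
    refine absurd (hwt v hv hne) (not_lt.2 ?_)
    rw [← hT]
    refine swt_le_card v T fun i hi => ?_
    obtain ⟨j, rfl⟩ := hval i hi
    exact congrFun h0 j
  have hinj' : Function.Injective (π.domRestrict G) := by
    rw [← LinearMap.ker_eq_bot, LinearMap.ker_eq_bot']
    exact fun v hv => Subtype.ext (hinj v v.2 hv)
  have hsurj : Function.Surjective (π.domRestrict G) := by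
    have hfr : Module.finrank F G = Module.finrank F (Fin N → F × F) := by
      rw [Module.finrank_pi_fintype]
      simp
      omega
    exact (LinearMap.injective_iff_surjective_of_finrank_eq_finrank hfr).1 hinj'
  intro v hv
  -- Lifts of vectors supported at one position have weight at most `m + 1`, and they sum to `v`.
  choose g hg using fun j => hsurj (Pi.single j (π v j))
  have hg' : ∀ j, π (g j) = Pi.single j (π v j) := hg
  have hv' : v = ∑ j, (g j : Vec F n) := by
    rw [← sub_eq_zero]
    refine hinj _ (G.sub_mem hv (G.sum_mem fun j _ => (g j).2)) ?_
    rw [map_sub, map_sum, sub_eq_zero, Finset.sum_congr rfl fun j _ => hg' j,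
      Finset.univ_sum_single]
  rw [hv']
  refine C.sum_mem fun j _ => hC _ (g j).2 ?_
  refine (swt_le_card _ (insert (Fin.castLE hN j) T) fun i hi => ?_).trans
    ((Finset.card_insert_le _ _).trans (by rw [hT]))
  rw [Finset.mem_insert, not_or] at hi
  obtain ⟨j', rfl⟩ := hval i hi.2
  have hjj : j' ≠ j := fun h => hi.1 (by rw [h])
  have := congrFun (hg' j) j'
  rwa [Pi.single_eq_of_ne hjj] at this

end Weight

/-- An isotropic linear code whose symplectic dual meets the Singleton bound gives pure MDS
subsystem codes for all splittings `k + r` of the logical degrees of freedom. -/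
theorem existsPureLinearMDS_of_isotropic (p : ℕ) [Fact p.Prime] {F : Type*} [Field F] [Fintype F]
    [DecidableEq F] [Algebra (ZMod p) F] {n : ℕ} (D : Submodule F (Vec F n))
    (hD : D ≤ (sympForm F n).orthogonal D) (m : ℕ) (hDm : Module.finrank F D = 2 * m)
    (hwt : ∀ v ∈ (sympForm F n).orthogonal D, v ≠ 0 → m < swt v) (hmn : m < n)
    (k r : ℕ) (hkr : 2 * m + (r + k) = n) :
    ExistsPureLinearMDS p F n k r (m + 1) := by
  obtain ⟨C, -, hCG, hrad, Q, hQ, hdet⟩ := exists_subsystem p D hD k r (by omega)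
  have hG : Module.finrank F ((sympForm F n).orthogonal D) + 2 * m = 2 * n := by
    rw [LinearMap.BilinForm.finrank_orthogonal sympForm_nondegenerate, finrank_vec]
    omega
  set G := (sympForm F n).orthogonal D with hGdef
  have hdual : traceSympDual p (radical p C.toAddSubgroup) = G.toAddSubgroup := by
    rw [hrad, traceSympDual_toAddSubgroup]
  refine ⟨⟨C, ⟨⟨Q, hQ, fun e he => ?_⟩, fun hne => ?_, fun heq => ?_⟩, fun v hv => hwt v (hCG hv)⟩,
    by omega⟩
  -- Among errors of weight at most `m`, only the identity lies in `G`; all others are detected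
  -- because they lie outside `D^⊥`.
  · by_cases heG : e ∈ G
    · have : e = 0 := by
        by_contra hne
        have := hwt e heG hne
        omega
      rw [this, errorOp_zero]
      exact ⟨1, by rw [Matrix.mul_one, Q.isometry, Matrix.one_kronecker_one]⟩
    · exact hdet e heG
  · rw [hdual] at hne ⊢
    obtain ⟨v, hvG, hvw, hvC⟩ : ∃ v ∈ G, swt v ≤ m + 1 ∧ v ∉ C := by
      by_contra! hcon
      exact hne (congrArg _ (le_antisymm (le_of_forall_swt_le_mem G C m hmn.le hG hwt hcon) hCG))
    have hv0 : v ≠ 0 := fun h => hvC (h ▸ C.zero_mem)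
    refine ⟨⟨v, ⟨⟨hvG, hvC⟩, hv0⟩, le_antisymm hvw (hwt v hvG hv0)⟩, ?_⟩
    rintro _ ⟨u, ⟨⟨huG, -⟩, hu0⟩, rfl⟩
    exact hwt u huG hu0
  · rw [hdual]
    -- If no nonzero word had weight at most `m + 1`, spanning would force `G = ⊥`, contradicting
    -- its dimension `2(n - m) > 0`.
    obtain ⟨v, hvG, hvw, hv0⟩ : ∃ v ∈ G, swt v ≤ m + 1 ∧ v ∉ (⊥ : Submodule F (Vec F n)) := by
      by_contra! hcon
      have hle := le_of_forall_swt_le_mem G ⊥ m hmn.le hG hwt hcon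
      have := Submodule.finrank_mono hle
      rw [finrank_bot] at this
      omega
    refine ⟨⟨v, ⟨hvG, hv0⟩, le_antisymm hvw (hwt v hvG hv0)⟩, ?_⟩
    rintro _ ⟨u, ⟨huG, hu0⟩, rfl⟩
    exact hwt u huG hu0

/-! ### Reed-Solomon codes over the quadratic extension -/

section ReedSolomon
open Polynomial in
/-- Interpolation: a polynomial of degree less than `m` with a prescribed value at one node and
zeros at fewer than `m` other nodes. -/
theorem exists_coeff_interpolating {E ι : Type*} [Field E] [DecidableEq ι] {α : ι → E}
    (hα : Function.Injective α) (s : Finset ι) {m : ℕ} (hs : s.card ≤ m) {i : ι} (hi : i ∈ s)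
    (y : E) : ∃ c : Fin m → E, (∑ l : Fin m, α i ^ (l : ℕ) * c l = y) ∧
      ∀ j ∈ s, j ≠ i → ∑ l : Fin m, α j ^ (l : ℕ) * c l = 0 := by
  let f : E[X] := ∏ j ∈ s.erase i, (X - C (α j))
  have hf : f.eval (α i) ≠ 0 := by
    rw [eval_prod, Finset.prod_ne_zero_iff]
    intro j hj
    rw [eval_sub, eval_X, eval_C, sub_ne_zero]
    exact fun h => Finset.ne_of_mem_erase hj (hα h).symm
  have hdeg : (C (y / f.eval (α i)) * f).natDegree < m := by
    have h1 : f.natDegree = (s.erase i).card := natDegree_finsetProd_X_sub_C_eq_card _ _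
    have h2 := Finset.card_erase_lt_of_mem hi
    have h3 := natDegree_C_mul_le (y / f.eval (α i)) f
    omega
  have heval : ∀ x, ∑ l : Fin m, x ^ (l : ℕ) * (C (y / f.eval (α i)) * f).coeff l =
      (C (y / f.eval (α i)) * f).eval x := fun x => by
    rw [eval_eq_sum_range' hdeg, Finset.sum_range]
    exact Finset.sum_congr rfl fun _ _ => mul_comm _ _
  refine ⟨fun l => (C (y / f.eval (α i)) * f).coeff l, ?_, fun j hj hji => ?_⟩
  · rw [heval, eval_mul, eval_C, div_mul_cancel₀ _ hf]
  · have : f.eval (α j) = 0 := by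
      rw [eval_prod]
      exact Finset.prod_eq_zero (Finset.mem_erase.2 ⟨hji, hj⟩) (by simp)
    rw [heval, eval_mul, this, mul_zero]

variable {F E : Type*} [Field F] [Field E] [Algebra F E]

/-- The evaluations of polynomials over a quadratic extension, written in coordinates, with the
second coordinates rescaled. -/
def evalCoords {n : ℕ} (m : ℕ) (bs : Module.Basis (Fin 2) F E) (α : Fin n → E) (w : Fin n → F) :
    (Fin m → E) →ₗ[F] Vec F n where
  toFun c := (fun i => bs.repr (∑ l : Fin m, α i ^ (l : ℕ) * c l) 0,
    fun i => w i * bs.repr (∑ l : Fin m, α i ^ (l : ℕ) * c l) 1)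
  map_add' c d := by
    ext i <;> simp [mul_add, Finset.sum_add_distrib]
  map_smul' t c := by
    have : ∀ i, ∑ l : Fin m, α i ^ (l : ℕ) * (t • c) l =
        t • ∑ l : Fin m, α i ^ (l : ℕ) * c l := fun i => by
      rw [Finset.smul_sum]
      exact Finset.sum_congr rfl fun l _ => by rw [Pi.smul_apply, mul_smul_comm]
    simp only [this, map_smul, Finsupp.smul_apply, smul_eq_mul, mul_left_comm _ t]
    rfl

theorem evalCoords_fst {n m : ℕ} (bs : Module.Basis (Fin 2) F E) (α : Fin n → E) (w : Fin n → F)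
    (c : Fin m → E) (i : Fin n) : (evalCoords m bs α w c).1 i =
      bs.repr (∑ l : Fin m, α i ^ (l : ℕ) * c l) 0 := rfl

theorem evalCoords_snd {n m : ℕ} (bs : Module.Basis (Fin 2) F E) (α : Fin n → E) (w : Fin n → F)
    (c : Fin m → E) (i : Fin n) : (evalCoords m bs α w c).2 i =
      w i * bs.repr (∑ l : Fin m, α i ^ (l : ℕ) * c l) 1 := rfl

variable [Fintype F]

/-- The `q`-Frobenius has order equal to the degree of the extension, here two. This is what makes
the constant `κ` below nonzero. -/
theorem frobenius_ne_id [Finite E] (h2 : Module.finrank F E = 2) :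
    ∃ x : E, x ^ Fintype.card F ≠ x := by
  by_contra! hcon
  have h1 := FiniteField.orderOf_frobeniusAlgHom F E
  have : FiniteField.frobeniusAlgHom F E = 1 := AlgHom.ext fun x => by
    rw [FiniteField.coe_frobeniusAlgHom]
    exact hcon x
  rw [this, orderOf_one, h2] at h1
  omega

/-- Hermitian orthogonality over the quadratic extension implies symplectic orthogonality of the
coordinates. -/
theorem sum_det_eq_zero [Finite E] (bs : Module.Basis (Fin 2) F E) {n : ℕ} (w : Fin n → F)
    (u v : Fin n → E)
    (huv : ∑ i, algebraMap F E (w i) * (u i * v i ^ Fintype.card F) = 0)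
    (hvu : ∑ i, algebraMap F E (w i) * (v i * u i ^ Fintype.card F) = 0) :
    ∑ i, w i * (bs.repr (u i) 0 * bs.repr (v i) 1 - bs.repr (v i) 0 * bs.repr (u i) 1) = 0 := by
  have h2 : Module.finrank F E = 2 := by simp [Module.finrank_eq_card_basis bs]
  -- The map `(x, y) ↦ x y^q - y x^q` is `F`-bilinear and alternating on a plane, hence a multiple
  -- of the determinant; `κ` is its value on the basis.
  set κ : E := bs 0 * bs 1 ^ Fintype.card F - bs 1 * bs 0 ^ Fintype.card F with hκdef
  have hdet : ∀ x y : E, x * y ^ Fintype.card F - y * x ^ Fintype.card F =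
      κ * algebraMap F E (bs.repr x 0 * bs.repr y 1 - bs.repr y 0 * bs.repr x 1) := by
    intro x y
    have hx : ∀ x : E, x = algebraMap F E (bs.repr x 0) * bs 0 +
        algebraMap F E (bs.repr x 1) * bs 1 := fun x => by
      conv_lhs => rw [← bs.sum_repr x]
      simp [Algebra.smul_def]
    have hxq : ∀ x : E, x ^ Fintype.card F = algebraMap F E (bs.repr x 0) * bs 0 ^ Fintype.card F +
        algebraMap F E (bs.repr x 1) * bs 1 ^ Fintype.card F := fun x => by
      have := congrArg (FiniteField.frobeniusAlgHom F E) (hx x)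
      rw [map_add, map_mul, map_mul, AlgHom.commutes, AlgHom.commutes] at this
      simpa only [FiniteField.coe_frobeniusAlgHom] using this
    rw [hxq x, hxq y, map_sub, map_mul, map_mul, hκdef]
    linear_combination
      (algebraMap F E (bs.repr y 0) * bs 0 ^ Fintype.card F +
        algebraMap F E (bs.repr y 1) * bs 1 ^ Fintype.card F) * hx x -
      (algebraMap F E (bs.repr x 0) * bs 0 ^ Fintype.card F +
        algebraMap F E (bs.repr x 1) * bs 1 ^ Fintype.card F) * hx y
  have hκ : κ ≠ 0 := by
    intro h0
    obtain ⟨x, hx⟩ := frobenius_ne_id (F := F) h2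
    have := hdet x 1
    rw [h0, zero_mul, one_pow, mul_one, one_mul, sub_eq_zero] at this
    exact hx this.symm
  have h3 : κ * algebraMap F E (∑ i, w i * (bs.repr (u i) 0 * bs.repr (v i) 1 -
      bs.repr (v i) 0 * bs.repr (u i) 1)) = 0 := by
    rw [map_sum, Finset.mul_sum, ← sub_self (0 : E)]
    nth_rewrite 1 [← huv]
    rw [← hvu, ← Finset.sum_sub_distrib]
    refine Finset.sum_congr rfl fun i _ => ?_
    rw [map_mul, ← mul_sub, hdet]
    ring
  exact (map_eq_zero _).1 ((mul_eq_zero.1 h3).resolve_left hκ)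

variable [DecidableEq F]

/-- Hermitian self-orthogonal Reed-Solomon codes over a quadratic extension, with norms of column
multipliers `w`, give pure MDS subsystem codes. -/
theorem existsPureLinearMDS_of_evaluation (p : ℕ) [Fact p.Prime] [Algebra (ZMod p) F] [Finite E]
    (h2 : Module.finrank F E = 2) {n m : ℕ} (hmn : m < n) (α : Fin n → E)
    (hα : Function.Injective α) (w : Fin n → F) (hw : ∀ i, w i ≠ 0)
    (hsum : ∀ a b, a < m → b < m →
      ∑ i, algebraMap F E (w i) * α i ^ (a + Fintype.card F * b) = 0)
    (k r : ℕ) (hkr : 2 * m + (r + k) = n) : ExistsPureLinearMDS p F n k r (m + 1) := by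
  have : FiniteDimensional F E := Module.finite_of_finrank_pos (by omega)
  let bs : Module.Basis (Fin 2) F E := Module.finBasisOfFinrankEq F E h2
  have hherm : ∀ c d : Fin m → E, ∑ i, algebraMap F E (w i) *
      ((∑ l : Fin m, α i ^ (l : ℕ) * c l) *
        (∑ l : Fin m, α i ^ (l : ℕ) * d l) ^ Fintype.card F) = 0 := by
    intro c d
    have h1 : ∀ i, (∑ l : Fin m, α i ^ (l : ℕ) * d l) ^ Fintype.card F =
        ∑ l : Fin m, α i ^ (Fintype.card F * l) * d l ^ Fintype.card F := by
      intro i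
      have := map_sum (FiniteField.frobeniusAlgHom F E)
        (fun l : Fin m => α i ^ (l : ℕ) * d l) Finset.univ
      simp only [FiniteField.coe_frobeniusAlgHom] at this
      rw [this]
      refine Finset.sum_congr rfl fun l _ => ?_
      rw [mul_pow, ← pow_mul, mul_comm (l : ℕ)]
    simp only [h1, Finset.sum_mul_sum]
    simp only [Finset.mul_sum]
    rw [Finset.sum_comm]
    refine Finset.sum_eq_zero fun a _ => ?_
    rw [Finset.sum_comm]
    refine Finset.sum_eq_zero fun b _ => ?_
    rw [← mul_zero (c a * d b ^ Fintype.card F), ← hsum a b a.2 b.2, Finset.mul_sum]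
    refine Finset.sum_congr rfl fun i _ => ?_
    rw [pow_add]
    ring
  have hinj : Function.Injective (evalCoords m bs α w) := by
    -- The first `m` nodes already determine the coefficients, by the Vandermonde determinant.
    rw [← LinearMap.ker_eq_bot, LinearMap.ker_eq_bot']
    intro c hc
    refine Matrix.eq_zero_of_forall_index_sum_pow_mul_eq_zero
      (hα.comp (Fin.castLE_injective hmn.le)) fun j => ?_
    apply bs.repr.injective
    ext t
    fin_cases t
    · rw [map_zero]
      exact congrFun (congrArg Prod.fst hc) (Fin.castLE hmn.le j)
    · rw [map_zero]
      have := congrFun (congrArg Prod.snd hc) (Fin.castLE hmn.le j)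
      exact (mul_eq_zero.1 this).resolve_left (hw _)
  refine existsPureLinearMDS_of_isotropic p (LinearMap.range (evalCoords m bs α w)) ?_ m ?_ ?_
    hmn k r hkr
  · rintro _ ⟨c, rfl⟩ _ ⟨d, rfl⟩
    change sympForm F n _ _ = 0
    rw [sympForm_apply, ← sum_det_eq_zero bs w _ _ (hherm c d) (hherm d c), dotProduct, dotProduct,
      ← Finset.sum_sub_distrib]
    refine Finset.sum_congr rfl fun i _ => ?_
    simp only [evalCoords_fst, evalCoords_snd]
    ring
  · rw [LinearMap.finrank_range_of_inj hinj, Module.finrank_pi_fintype]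
    simp [h2, mul_comm]
  · intro v hv hv0
    by_contra hlt
    let s : Finset (Fin n) := Finset.univ.filter fun i : Fin n => (v.1 i, v.2 i) ≠ (0, 0)
    have hs : s.card ≤ m := not_lt.1 hlt
    have hout : ∀ i, i ∉ s → v.1 i = 0 ∧ v.2 i = 0 := fun i hi => by
      simpa [s, not_or] using hi
    refine hv0 ?_
    -- A polynomial vanishing on the rest of the support of `v` and equal to `y` at node `i` reduces
    -- the pairing with `v` to its `i`-th term. Letting `y` run over the basis kills both
    -- coordinates there.
    have key : ∀ i ∈ s, ∀ y : E, v.1 i * (w i * bs.repr y 1) - bs.repr y 0 * v.2 i = 0 := by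
      intro i hi y
      obtain ⟨c, hc1, hc0⟩ := exists_coeff_interpolating hα s hs hi y
      have h0 : sympForm F n (evalCoords m bs α w c) v = 0 := hv _ ⟨c, rfl⟩
      rw [sympForm_apply, dotProduct, dotProduct, ← Finset.sum_sub_distrib,
        Finset.sum_eq_single i] at h0
      · rw [← h0, ← hc1]
        rfl
      · intro j _ hji
        by_cases hj : j ∈ s
        · rw [evalCoords_fst, evalCoords_snd, hc0 j hj hji]
          simp
        · simp [(hout j hj).1, (hout j hj).2]
      · simp
    have hz : ∀ i, v.1 i = 0 ∧ v.2 i = 0 := by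
      intro i
      by_cases hi : i ∈ s
      · have h0 := key i hi (bs 0)
        have h1 := key i hi (bs 1)
        simp at h0 h1
        exact ⟨h1.resolve_right (hw i), h0⟩
      · exact hout i hi
    exact Prod.ext (funext fun i => (hz i).1) (funext fun i => (hz i).2)

/-- The evaluation construction with nodes given as a finite set. -/
theorem existsPureLinearMDS_of_finset (p : ℕ) [Fact p.Prime] [Algebra (ZMod p) F] [Finite E]
    (h2 : Module.finrank F E = 2) {n m : ℕ} (hmn : m < n) (S : Finset E) (hS : S.card = n)
    (w : E → F) (hw : ∀ x ∈ S, w x ≠ 0)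
    (hsum : ∀ a b, a < m → b < m →
      ∑ x ∈ S, algebraMap F E (w x) * x ^ (a + Fintype.card F * b) = 0)
    (k r : ℕ) (hkr : 2 * m + (r + k) = n) : ExistsPureLinearMDS p F n k r (m + 1) := by
  let e : Fin n ≃ S := (S.equivFinOfCardEq hS).symm
  refine existsPureLinearMDS_of_evaluation p h2 hmn (fun i => (e i : E))
    (Subtype.val_injective.comp e.injective) (fun i => w (e i)) (fun i => hw _ (e i).2)
    (fun a b ha hb => ?_) k r hkr
  rw [← hsum a b ha hb, ← Finset.sum_coe_sort S]
  exact Fintype.sum_equiv e _ _ fun _ => rfl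

end ReedSolomon

/-! ### Vanishing power sums -/

section PowerSums
variable {F E : Type*} [Field F] [Fintype F] [Field E] [Algebra F E]

open MvPolynomial in
/-- A bivariate polynomial of total degree less than `2 (q - 1)` over an extension of `F` sums to
zero over the `F`-rational points. -/
theorem sum_eval_algebraMap_eq_zero (f : MvPolynomial (Fin 2) E)
    (hf : f.totalDegree < 2 * (Fintype.card F - 1)) :
    ∑ x : F × F, eval ![algebraMap F E x.1, algebraMap F E x.2] f = 0 := by
  simp only [eval_eq', Fin.prod_univ_two]
  rw [Finset.sum_comm]
  refine Finset.sum_eq_zero fun d hd => ?_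
  have hle := le_totalDegree hd
  rw [Finsupp.sum_fintype _ _ fun _ => rfl, Fin.sum_univ_two] at hle
  rw [← Finset.mul_sum, Fintype.sum_prod_type]
  have : ∑ s : F, ∑ t : F, algebraMap F E s ^ d 0 * algebraMap F E t ^ d 1 =
      algebraMap F E ((∑ s : F, s ^ d 0) * ∑ t : F, t ^ d 1) := by
    rw [Finset.sum_mul_sum]
    simp only [map_sum, map_mul, map_pow]
  simp only [Matrix.cons_val_zero, Matrix.cons_val_one]
  rw [this]
  -- The degree bound forces one of the two exponents below `q - 1`, and that factor is zero.
  rcases lt_or_ge (d 0) (Fintype.card F - 1) with h | h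
  · rw [FiniteField.sum_pow_lt_card_sub_one F _ h, zero_mul, map_zero, mul_zero]
  · rw [FiniteField.sum_pow_lt_card_sub_one F (d 1) (by omega), mul_zero, map_zero, mul_zero]

open MvPolynomial in
theorem totalDegree_linear_pow_le (u v : E) (a : ℕ) :
    ((X 0 * C u + X 1 * C v : MvPolynomial (Fin 2) E) ^ a).totalDegree ≤ a := by
  have h : (X 0 * C u + X 1 * C v : MvPolynomial (Fin 2) E).totalDegree ≤ 1 := by
    refine (totalDegree_add _ _).trans (max_le ?_ ?_) <;>
      exact (totalDegree_mul _ _).trans (by simp)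
  exact (totalDegree_pow _ a).trans ((Nat.mul_le_mul_left a h).trans (mul_one a).le)

open MvPolynomial in
/-- Power sums over a union of parallel lines in a quadratic extension, weighted by the polynomial
that vanishes on the complementary lines. -/
theorem sum_parallel_lines_eq_zero (ε : (F × F) ≃ₗ[F] E) (T : Finset F) (a b : ℕ)
    (h : T.card + a + b < 2 * (Fintype.card F - 1)) :
    ∑ x : F × F, algebraMap F E (∏ c ∈ T, (x.1 - c)) * ε x ^ (a + Fintype.card F * b) = 0 := by
  set e₀ := ε (1, 0)
  set e₁ := ε (0, 1)
  have hε : ∀ x, ε x = algebraMap F E x.1 * e₀ + algebraMap F E x.2 * e₁ := fun x => by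
    rw [← Algebra.smul_def, ← Algebra.smul_def, ← map_smul, ← map_smul, ← map_add]
    simp
  have hεq : ∀ x, ε x ^ Fintype.card F =
      algebraMap F E x.1 * e₀ ^ Fintype.card F + algebraMap F E x.2 * e₁ ^ Fintype.card F := by
    intro x
    have := congrArg (FiniteField.frobeniusAlgHom F E) (hε x)
    rw [map_add, map_mul, map_mul, AlgHom.commutes, AlgHom.commutes] at this
    simpa only [FiniteField.coe_frobeniusAlgHom] using this
  let f : MvPolynomial (Fin 2) E := (∏ c ∈ T, (X 0 - C (algebraMap F E c))) *
    ((X 0 * C e₀ + X 1 * C e₁) ^ a *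
      (X 0 * C (e₀ ^ Fintype.card F) + X 1 * C (e₁ ^ Fintype.card F)) ^ b)
  have h₀ : (∏ c ∈ T, (X 0 - C (algebraMap F E c)) : MvPolynomial (Fin 2) E).totalDegree ≤
      T.card := by
    refine (totalDegree_finsetProd _ _).trans ?_
    refine (Finset.sum_le_card_nsmul T _ 1 fun c _ => ?_).trans (by simp)
    exact (totalDegree_sub_C_le _ _).trans (by simp)
  have hf : f.totalDegree ≤ T.card + (a + b) :=
    (totalDegree_mul _ _).trans (add_le_add h₀ ((totalDegree_mul _ _).trans
      (add_le_add (totalDegree_linear_pow_le _ _ a) (totalDegree_linear_pow_le _ _ b))))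
  rw [← sum_eval_algebraMap_eq_zero (F := F) f (by omega)]
  refine Finset.sum_congr rfl fun x _ => ?_
  rw [pow_add, pow_mul, hεq, hε]
  simp [f, map_prod]

end PowerSums

/-! ### The four choices of nodes and weights -/

section Families
variable (p : ℕ) [Fact p.Prime] {F : Type*} [Field F] [Fintype F]

/-- A finite field has a finite quadratic extension. -/
theorem exists_quadratic_extension (F : Type*) [Field F] [Finite F] [Algebra (ZMod p) F] :
    ∃ (E : Type) (_ : Field E) (_ : Fintype E) (_ : Algebra F E), Module.finrank F E = 2 := by
  have : CharP F p := charP_of_injective_algebraMap (algebraMap (ZMod p) F).injective p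
  exact ⟨FiniteField.Extension F p 2, inferInstance, Fintype.ofFinite _, inferInstance,
    FiniteField.finrank_extension F p 2⟩

theorem card_quadratic_extension {E : Type*} [Field E] [Fintype E] [Algebra F E]
    (h2 : Module.finrank F E = 2) : Fintype.card E = Fintype.card F ^ 2 := by
  rw [Module.card_eq_pow_finrank (K := F), h2]

variable [DecidableEq F] [Algebra (ZMod p) F]

/-- On `F` one has `x^q = x`, so the exponent `b + q c` becomes `b + c ≤ 2m - 2 < n - 1`. With
Lagrange weights the sum is the coefficient of `X^(n-1)` in `X^(b+c)`, which is zero. -/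
theorem existsPureLinearMDS_of_le_card {n m : ℕ} (hn : n ≤ Fintype.card F) (hm : 2 * m + 1 ≤ n)
    (k r : ℕ) (hkr : 2 * m + (r + k) = n) : ExistsPureLinearMDS p F n k r (m + 1) := by
  obtain ⟨E, _, _, _, h2⟩ := exists_quadratic_extension p F
  obtain ⟨a⟩ : Nonempty (Fin n ↪ F) := Function.Embedding.nonempty_of_card_le (by simpa using hn)
  refine existsPureLinearMDS_of_evaluation p h2 (by omega) (fun i => algebraMap F E (a i))
    ((algebraMap F E).injective.comp a.injective)
    (fun i => (∏ j ∈ Finset.univ.erase i, (a i - a j))⁻¹) (fun i => ?_) (fun b c hb hc => ?_)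
    k r hkr
  · refine inv_ne_zero (Finset.prod_ne_zero_iff.2 fun j hj => sub_ne_zero.2 fun h => ?_)
    exact Finset.ne_of_mem_erase hj (a.injective h).symm
  · have h0 := Lagrange.coeff_eq_sum (s := Finset.univ) (v := a) a.injective.injOn
      (P := (Polynomial.X ^ (b + c) : Polynomial F))
      (by rw [Polynomial.degree_X_pow, Finset.card_univ, Fintype.card_fin]; norm_cast; omega)
    rw [Polynomial.coeff_X_pow, if_neg (by simp; omega)] at h0
    simp only [Polynomial.eval_pow, Polynomial.eval_X] at h0
    rw [← map_zero (algebraMap F E), h0, map_sum]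
    refine Finset.sum_congr rfl fun i _ => ?_
    rw [← map_pow, ← map_mul, pow_add, pow_mul, FiniteField.pow_card, ← pow_add, div_eq_mul_inv,
      mul_comm]

/-- The nodes form `ν + 1` parallel lines in `E ≅ F^2`; the weight is the product of the equations
of the other lines, so the sum extends to the whole plane. As `x ↦ x^q` is `F`-linear, the degree is
at most `(q - ν - 1) + 2ν`, below `2(q - 1)` exactly when `ν + 2 ≤ q`. -/
theorem existsPureLinearMDS_parallel_lines {ν : ℕ} (hν : ν + 2 ≤ Fintype.card F)
    (k r : ℕ) (hkr : 2 * (ν + 1) + (r + k) = (ν + 1) * Fintype.card F)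
    (hkr' : 0 < r + k) :
    ExistsPureLinearMDS p F ((ν + 1) * Fintype.card F) k r (ν + 2) := by
  obtain ⟨E, _, _, _, h2⟩ := exists_quadratic_extension p F
  have : FiniteDimensional F E := Module.finite_of_finrank_pos (by omega)
  let ε : (F × F) ≃ₗ[F] E := LinearEquiv.ofFinrankEq _ _ (by simp [h2])
  obtain ⟨U, hU⟩ := Finset.exists_subset_card_eq
    (s := (Finset.univ : Finset F)) (n := ν + 1) (by rw [Finset.card_univ]; omega)
  have hT : Uᶜ.card + (ν + 1) = Fintype.card F := by
    rw [← hU.2, Finset.card_compl_add_card]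
  refine existsPureLinearMDS_of_finset p h2 (by omega)
    ((U ×ˢ (Finset.univ : Finset F)).map ε.toEquiv.toEmbedding) ?_
    (fun x => ∏ c ∈ Uᶜ, ((ε.symm x).1 - c)) ?_ ?_ k r hkr
  · rw [Finset.card_map, Finset.card_product, hU.2, Finset.card_univ]
  · intro x hx
    obtain ⟨y, hy, rfl⟩ := Finset.mem_map.1 hx
    refine Finset.prod_ne_zero_iff.2 fun c hc => sub_ne_zero.2 ?_
    rintro rfl
    refine Finset.mem_compl.1 hc ?_
    simpa using hy
  · intro a b ha hb
    rw [← sum_parallel_lines_eq_zero ε Uᶜ a b (by omega), Finset.sum_map]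
    refine Finset.sum_subset_zero_on_sdiff (Finset.subset_univ _) (fun x hx => ?_) fun x _ => ?_
    · have hxU : x.1 ∈ Uᶜ := by simpa using hx
      rw [Finset.prod_eq_zero hxU (sub_self _), map_zero, zero_mul]
    · simp

/-- Norm weights `x^(q+1)` shift the exponent to `(a + 1) + q (b + 1)`. It is positive, so the
missing node `0` contributes nothing, and less than `q^2 - 1`, so the sum over `E` vanishes. -/
theorem existsPureLinearMDS_units {m : ℕ} (hm : m + 2 ≤ Fintype.card F) (k r : ℕ)
    (hkr : 2 * m + (r + k) = Fintype.card F ^ 2 - 1) (hkr' : 0 < r + k) :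
    ExistsPureLinearMDS p F (Fintype.card F ^ 2 - 1) k r (m + 1) := by
  classical
  obtain ⟨E, _, _, _, h2⟩ := exists_quadratic_extension p F
  have hE := card_quadratic_extension h2
  have hnorm : ∀ x : E, algebraMap F E (Algebra.norm F x) = x ^ (1 + Fintype.card F) := fun x => by
    rw [FiniteField.algebraMap_norm_eq_prod_pow, h2, Finset.prod_range_succ, Finset.prod_range_one,
      Nat.card_eq_fintype_card, pow_zero, pow_one, pow_one, pow_add, pow_one]
  refine existsPureLinearMDS_of_finset p h2 (by omega) (Finset.univ.erase (0 : E)) ?_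
    (fun x => Algebra.norm F x) ?_ ?_ k r hkr
  · rw [Finset.card_erase_of_mem (Finset.mem_univ _), Finset.card_univ, hE]
  · intro x hx h0
    have := hnorm x
    rw [h0, map_zero] at this
    exact Finset.ne_of_mem_erase hx (pow_eq_zero_iff (by omega) |>.1 this.symm)
  · intro a b ha hb
    have hlt : a + 1 + Fintype.card F * (b + 1) < Fintype.card E - 1 := by
      rw [hE]
      have h1 : Fintype.card F * (b + 1) + 2 * Fintype.card F ≤ Fintype.card F ^ 2 := by
        have := Nat.mul_le_mul_left (Fintype.card F) (show b + 1 + 2 ≤ Fintype.card F by omega)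
        linarith
      omega
    refine Eq.trans ?_ (FiniteField.sum_pow_lt_card_sub_one E _ hlt)
    have h0 : (0 : E) ^ (a + 1 + Fintype.card F * (b + 1)) = 0 := zero_pow (by omega)
    refine (Finset.sum_congr rfl fun x _ => ?_).trans (Finset.sum_erase Finset.univ h0)
    rw [hnorm, ← pow_add]
    congr 1
    ring

/-- With all of `E` as nodes, unit weights suffice: `a, b ≤ q - 2` gives `a + q b ≤ q^2 - q - 2 <
q^2 - 1`. -/
theorem existsPureLinearMDS_full {m : ℕ} (hm : m + 1 ≤ Fintype.card F) (k r : ℕ)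
    (hkr : 2 * m + (r + k) = Fintype.card F ^ 2) (hkr' : 0 < r + k) :
    ExistsPureLinearMDS p F (Fintype.card F ^ 2) k r (m + 1) := by
  obtain ⟨E, _, _, _, h2⟩ := exists_quadratic_extension p F
  have hE := card_quadratic_extension h2
  refine existsPureLinearMDS_of_finset p h2 (by omega) (Finset.univ : Finset E) ?_
    (fun _ => 1) (fun _ _ => one_ne_zero) (fun a b ha hb => ?_) k r hkr
  · rw [Finset.card_univ, hE]
  · have hlt : a + Fintype.card F * b < Fintype.card E - 1 := by
      rw [hE]
      have h1 : Fintype.card F * b + 2 * Fintype.card F ≤ Fintype.card F ^ 2 := by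
        have := Nat.mul_le_mul_left (Fintype.card F) (show b + 2 ≤ Fintype.card F by omega)
        linarith
      omega
    simpa using FiniteField.sum_pow_lt_card_sub_one E _ hlt

end Families

end

end SubsystemCodes

theorem mainTheorem11 (p : ℕ) [Fact p.Prime] (F : Type*) [Field F] [Fintype F] [DecidableEq F]
    [Algebra (ZMod p) F] (q : ℕ) (hq : Fintype.card F = q) :
    (∀ n d r : ℕ, 3 ≤ n → n ≤ q → 1 ≤ d → 2 * d ≤ n + 2 → r + 2 * d ≤ n + 1 →
      SubsystemCodes.ExistsPureLinearMDS p F n (n + 2 - 2 * d - r) r d) ∧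
    (∀ ν r : ℕ, ν + 2 ≤ q → r + 2 * ν + 3 ≤ (ν + 1) * q →
      SubsystemCodes.ExistsPureLinearMDS p F
        ((ν + 1) * q) ((ν + 1) * q - 2 * ν - 2 - r) r (ν + 2)) ∧
    (∀ δ r : ℕ, 2 * δ < q - 1 → r + 2 * δ + 1 ≤ q →
      SubsystemCodes.ExistsPureLinearMDS p F (q - 1) (q - 1 - 2 * δ - r) r (δ + 1)) ∧
    (∀ δ r : ℕ, 2 * δ < q - 1 → r + 2 * δ + 2 < q →
      SubsystemCodes.ExistsPureLinearMDS p F q (q - 2 * δ - 2 - r) r (δ + 2)) ∧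
    (∀ δ r : ℕ, δ < q - 1 → r + 2 * δ + 1 < q ^ 2 →
      SubsystemCodes.ExistsPureLinearMDS p F
        (q ^ 2 - 1) (q ^ 2 - 2 * δ - 1 - r) r (δ + 1)) ∧
    (∀ δ r : ℕ, δ < q - 1 → r + 2 * δ + 2 < q ^ 2 →
      SubsystemCodes.ExistsPureLinearMDS p F
        (q ^ 2) (q ^ 2 - 2 * δ - 2 - r) r (δ + 2)) := by
  subst hq
  refine ⟨?_, ?_, ?_, ?_, ?_, ?_⟩
  · intro n d r _ hnq hd _ hr
    obtain ⟨m, rfl⟩ := Nat.exists_eq_add_of_le' hd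
    exact SubsystemCodes.existsPureLinearMDS_of_le_card p hnq (by omega) _ _ (by omega)
  · intro ν r hν hr
    exact SubsystemCodes.existsPureLinearMDS_parallel_lines p hν _ _ (by omega) (by omega)
  · intro δ r hδ hr
    -- Lengths `q - 1` and, in the next case, `q` are at most `q`, so nodes in `F` serve for both.
    exact SubsystemCodes.existsPureLinearMDS_of_le_card p (Nat.sub_le _ _) (by omega) _ _
      (by omega)
  · intro δ r hδ hr
    exact SubsystemCodes.existsPureLinearMDS_of_le_card p le_rfl (by omega) _ _ (by omega)
  · intro δ r hδ hr
    exact SubsystemCodes.existsPureLinearMDS_units p (by omega) _ _ (by omega) (by omega)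
  · intro δ r hδ hr
    exact SubsystemCodes.existsPureLinearMDS_full p (by omega) _ _ (by omega) (by omega)
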